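/- Let $\Omega\subset\mathbf R^3$ be a bounded open set and let $\gamma\in L^\infty(\Omega)$ be real-valued with $C^{-1}\le\gamma\le C$ almost everywhere in $\Omega$ for some $C>0$. Let $H^1(\Omega)$ be the Sobolev space of complex-valued functions, $H^1_0(\Omega)$ the closure of $C_c^\infty(\Omega)$ in it, $H^{1/2}(\partial\Omega)=H^1(\Omega)/H^1_0(\Omega)$ the space of boundary traces (for smooth $\partial\Omega$ this is the usual space), and $H^{-1/2}(\partial\Omega)$ its dual. Then for every $f\in H^{1/2}(\partial\Omega)$ the problem $$\nabla\cdot\gamma\nabla u=0\ \text{ in }\Omega,\qquad u|_{\partial\Omega}=f$$ has a unique weak solution $u\in H^1(\Omega)$. Hence the Dirichlet-to-Neumann map $\Lambda_\gamma f=\gamma\,\partial u/\partial\nu|_{\partial\Omega}\in H^{-1/2}(\partial\Omega)$ is well defined in the weak sense, that is, $\langle\Lambda_\gamma f,v|_{\partial\Omega}\rangle=\int_\Omega\gamma\nabla u\cdot\nabla v\,dx$ for all $v\in H^1(\Omega)$; let $\Lambda_1$ be the map for $\gamma=1$. For $\xi\in\mathbf R^3$ and $\zeta\in\mathbf C^3$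 put $$\mathbf t^{\exp}(\xi,\zeta)=\int_{\partial\Omega}e^{-ix\cdot(\xi+\zeta)}\,(\Lambda_\gamma-\Lambda_1)e^{ix\cdot\zeta}\,d\sigma(x),$$ where $x\cdot\zeta=\sum_j x_j\zeta_j$ and the integral denotes the bilinear pairing of $H^{-1/2}(\partial\Omega)$ with $H^{1/2}(\partial\Omega)$. Then $|\mathbf t^{\exp}(\xi,\zeta_\xi)|=O(|\xi|^2)$ as $|\xi|\to0$, for the minimal frequencies $\zeta_\xi=-\xi/2+i\zeta_I$, uniformly in the choice of $\zeta_I$: there are $K,\delta>0$, depending on $\Omega$ and $\gamma$ only, such that $$|\mathbf t^{\exp}(\xi,\,-\xi/2+i\zeta_I)|\le K|\xi|^2$$ for all $\xi,\zeta_I\in\mathbf R^3$ with $|\xi|<\delta$, $\zeta_I\cdot\xi=0$ and $|\zeta_I|=|\xi|/2$. -/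

import Mathlib

open MeasureTheory
open scoped ContDiff

noncomputable section

namespace CalderonBorn

/-- Euclidean space `ℝ³`. -/
abbrev E3 : Type := EuclideanSpace ℝ (Fin 3)

/-- The complex space `L²(Ω)`. -/
abbrev L2 (Ω : Set E3) : Type := Lp ℂ 2 (volume.restrict Ω)

/-- The classical partial derivative `∂ᵢ f`. -/
def pderiv (i : Fin 3) (f : E3 → ℂ) (x : E3) : ℂ :=
  fderiv ℝ f x (EuclideanSpace.single i (1 : ℝ))

/-- `φ ∈ C_c^∞(Ω)`. -/
structure IsTest (Ω : Set E3) (φ : E3 → ℂ) : Prop where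
  smooth : ContDiff ℝ ∞ φ
  compact : HasCompactSupport φ
  support : tsupport φ ⊆ Ω

/-- Pairs consisting of a function in `L²(Ω)` and a vector field in `L²(Ω)³`, with the Hilbert
norm `(‖u‖² + ∑ᵢ ‖gᵢ‖²)^{1/2}`. -/
abbrev L2Pair (Ω : Set E3) : Type := WithLp 2 (L2 Ω × PiLp 2 (fun _ : Fin 3 => L2 Ω))

lemma continuous_pderiv {f : E3 → ℂ} (hf : ContDiff ℝ ∞ f) (i : Fin 3) :
    Continuous (pderiv i f) :=
  (hf.continuous_fderiv (by simp)).clm_apply continuous_const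

lemma IsTest.memLp {Ω : Set E3} {φ : E3 → ℂ} (hφ : IsTest Ω φ) :
    MemLp φ 2 (volume.restrict Ω) :=
  hφ.smooth.continuous.memLp_of_hasCompactSupport hφ.compact

lemma IsTest.hasCompactSupport_pderiv {Ω : Set E3} {φ : E3 → ℂ} (hφ : IsTest Ω φ) (i : Fin 3) :
    HasCompactSupport (pderiv i φ) :=
  hφ.compact.fderiv_apply (𝕜 := ℝ) _

lemma IsTest.memLp_pderiv {Ω : Set E3} {φ : E3 → ℂ} (hφ : IsTest Ω φ) (i : Fin 3) :
    MemLp (pderiv i φ) 2 (volume.restrict Ω) :=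
  (continuous_pderiv hφ.smooth i).memLp_of_hasCompactSupport (hφ.hasCompactSupport_pderiv i)

lemma integrable_L2_mul {Ω : Set E3} (u : L2 Ω) {g : E3 → ℂ}
    (hg : MemLp g 2 (volume.restrict Ω)) :
    Integrable (fun x => u x * g x) (volume.restrict Ω) :=
  (Lp.memLp u).integrable_mul hg

lemma integral_add_mul {Ω : Set E3} (u v : L2 Ω) {g : E3 → ℂ}
    (hg : MemLp g 2 (volume.restrict Ω)) :
    ∫ x in Ω, (u + v : L2 Ω) x * g x = (∫ x in Ω, u x * g x) + ∫ x in Ω, v x * g x := by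
  rw [← integral_add (integrable_L2_mul u hg) (integrable_L2_mul v hg)]
  refine integral_congr_ae ?_
  filter_upwards [Lp.coeFn_add u v] with x hx
  rw [hx, Pi.add_apply, add_mul]

lemma integral_smul_mul {Ω : Set E3} (c : ℂ) (u : L2 Ω) (g : E3 → ℂ) :
    ∫ x in Ω, (c • u : L2 Ω) x * g x = c * ∫ x in Ω, u x * g x := by
  rw [← integral_const_mul]
  refine integral_congr_ae ?_
  filter_upwards [Lp.coeFn_smul c u] with x hx
  rw [hx, Pi.smul_apply, smul_eq_mul, mul_assoc]

/-- The Sobolev space `H¹(Ω)` of complex functions in `L²(Ω)` with weak gradient in `L²(Ω)³`;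
an element is stored together with its weak gradient, and the norm is the `H¹` norm. -/
def H1 (Ω : Set E3) : Submodule ℂ (L2Pair Ω) where
  carrier := {p | ∀ φ : E3 → ℂ, IsTest Ω φ → ∀ i : Fin 3,
    ∫ x in Ω, p.fst x * pderiv i φ x = -∫ x in Ω, p.snd i x * φ x}
  zero_mem' := by
    intro φ hφ i
    have h1 := integral_smul_mul (Ω := Ω) 0 0 (pderiv i φ)
    have h2 := integral_smul_mul (Ω := Ω) 0 0 φ
    rw [zero_smul, zero_mul] at h1 h2
    simp only [WithLp.zero_fst, WithLp.zero_snd, PiLp.zero_apply]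
    rw [h1, h2, neg_zero]
  add_mem' := by
    intro p q hp hq φ hφ i
    simp only [WithLp.add_fst, WithLp.add_snd, PiLp.add_apply]
    rw [integral_add_mul _ _ (hφ.memLp_pderiv i), integral_add_mul _ _ hφ.memLp, hp φ hφ i,
      hq φ hφ i]
    ring
  smul_mem' := by
    intro c p hp φ hφ i
    simp only [WithLp.smul_fst, WithLp.smul_snd, PiLp.smul_apply]
    rw [integral_smul_mul, integral_smul_mul, hp φ hφ i]
    ring

/-- The `i`-th component of the weak gradient of `u ∈ H¹(Ω)`. -/
def grad {Ω : Set E3} (u : H1 Ω) (i : Fin 3) : L2 Ω := u.1.snd i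

/-- `u ∈ H¹(Ω)` is the class of the function `f`, with `∇f` as its gradient. -/
def Represents {Ω : Set E3} (u : H1 Ω) (f : E3 → ℂ) : Prop :=
  u.1.fst =ᵐ[volume.restrict Ω] f ∧ ∀ i, grad u i =ᵐ[volume.restrict Ω] pderiv i f

/-- `H¹₀(Ω)`: the closure of `C_c^∞(Ω)` in `H¹(Ω)`. -/
def H10 (Ω : Set E3) : Submodule ℂ (H1 Ω) :=
  (Submodule.span ℂ {u : H1 Ω | ∃ φ : E3 → ℂ, IsTest Ω φ ∧ Represents u φ}).topologicalClosure

/-- The trace space `H^{1/2}(∂Ω) = H¹(Ω) / H¹₀(Ω)`. -/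
abbrev TraceSpace (Ω : Set E3) : Type := H1 Ω ⧸ H10 Ω

/-- The space `H^{-1/2}(∂Ω)`, the (complex-linear) continuous dual of the trace space. -/
abbrev DualTraceSpace (Ω : Set E3) : Type := StrongDual ℂ (TraceSpace Ω)

/-- The boundary value `u|_{∂Ω}` of `u ∈ H¹(Ω)`. -/
def trace {Ω : Set E3} (u : H1 Ω) : TraceSpace Ω := (H10 Ω).mkQ u

lemma memLp_of_continuous {Ω : Set E3} (hΩ : IsOpen Ω) (hb : Bornology.IsBounded Ω)
    {f : E3 → ℂ} (hf : Continuous f) : MemLp f 2 (volume.restrict Ω) := by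
  have : IsFiniteMeasure (volume.restrict Ω) := ⟨by simpa using hb.measure_lt_top⟩
  obtain ⟨C, hC⟩ := hb.isCompact_closure.exists_bound_of_continuousOn hf.continuousOn
  exact MemLp.of_bound hf.aestronglyMeasurable C
    (ae_restrict_of_forall_mem hΩ.measurableSet fun x hx => hC x (subset_closure hx))

lemma integral_parts {Ω : Set E3} {f φ : E3 → ℂ} (hf : ContDiff ℝ ∞ f) (hφ : IsTest Ω φ)
    (i : Fin 3) :
    ∫ x in Ω, f x * pderiv i φ x = -∫ x in Ω, pderiv i f x * φ x := by
  have h0 : ∀ x, x ∉ Ω → φ x = 0 := fun x hx =>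
    image_eq_zero_of_notMem_tsupport fun h => hx (hφ.support h)
  have h1 : ∀ x, x ∉ Ω → pderiv i φ x = 0 := fun x hx => by
    have : fderiv ℝ φ x = 0 := fderiv_of_notMem_tsupport ℝ fun h => hx (hφ.support h)
    simp [pderiv, this]
  rw [setIntegral_eq_integral_of_forall_compl_eq_zero (fun x hx => by simp [h1 x hx]),
    setIntegral_eq_integral_of_forall_compl_eq_zero (fun x hx => by simp [h0 x hx])]
  refine integral_mul_fderiv_eq_neg_fderiv_mul_of_integrable ?_ ?_ ?_
    (fun x _ => hf.differentiable (by simp) x) (fun x _ => hφ.smooth.differentiable (by simp) x)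
  · exact ((continuous_pderiv hf i).mul hφ.smooth.continuous).integrable_of_hasCompactSupport
      hφ.compact.mul_left
  · exact (hf.continuous.mul (continuous_pderiv hφ.smooth i)).integrable_of_hasCompactSupport
      (hφ.hasCompactSupport_pderiv i).mul_left
  · exact (hf.continuous.mul hφ.smooth.continuous).integrable_of_hasCompactSupport
      hφ.compact.mul_left

/-- The restriction to a bounded open set `Ω` of a smooth function on `ℝ³`, as an element of
`H¹(Ω)`. -/
def ofSmooth {Ω : Set E3} (hΩ : IsOpen Ω) (hb : Bornology.IsBounded Ω) (f : E3 → ℂ)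
    (hf : ContDiff ℝ ∞ f) : H1 Ω :=
  ⟨WithLp.toLp 2 ((memLp_of_continuous hΩ hb hf.continuous).toLp f, WithLp.toLp 2 fun i =>
      (memLp_of_continuous hΩ hb (continuous_pderiv hf i)).toLp (pderiv i f)), by
    intro φ hφ i
    have e1 : ∫ x in Ω, ((memLp_of_continuous hΩ hb hf.continuous).toLp f) x * pderiv i φ x
        = ∫ x in Ω, f x * pderiv i φ x := by
      refine integral_congr_ae ?_
      filter_upwards [(memLp_of_continuous hΩ hb hf.continuous).coeFn_toLp] with x hx
      rw [hx]
    have e2 : ∫ x in Ω, ((memLp_of_continuous hΩ hb (continuous_pderiv hf i)).toLp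
        (pderiv i f)) x * φ x = ∫ x in Ω, pderiv i f x * φ x := by
      refine integral_congr_ae ?_
      filter_upwards [(memLp_of_continuous hΩ hb (continuous_pderiv hf i)).coeFn_toLp] with x hx
      rw [hx]
    exact e1.trans ((integral_parts hf hφ i).trans (congrArg Neg.neg e2.symm))⟩

/-- A real conductivity `γ ∈ L^∞(Ω)` with `C⁻¹ ≤ γ ≤ C` almost everywhere in `Ω`. -/
structure IsConductivity (Ω : Set E3) (γ : E3 → ℝ) : Prop where
  aesm : AEStronglyMeasurable γ (volume.restrict Ω)
  bounds : ∃ C : ℝ, 0 < C ∧ ∀ᵐ x ∂(volume.restrict Ω), C⁻¹ ≤ γ x ∧ γ x ≤ C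

lemma isConductivity_one (Ω : Set E3) : IsConductivity Ω (fun _ => 1) :=
  ⟨aestronglyMeasurable_const, 1, one_pos, by simp⟩

/-- The bilinear form `∫_Ω γ ∇u · ∇v dx` (no complex conjugation). -/
def energy {Ω : Set E3} (γ : E3 → ℝ) (u v : H1 Ω) : ℂ :=
  ∑ i : Fin 3, ∫ x in Ω, (γ x : ℂ) * (grad u i x * grad v i x)

/-- `u ∈ H¹(Ω)` is a weak solution of `∇ · γ∇u = 0` in `Ω`. -/
def IsWeakSolution {Ω : Set E3} (γ : E3 → ℝ) (u : H1 Ω) : Prop :=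
  ∀ φ ∈ H10 Ω, energy γ u φ = 0

lemma IsConductivity.memLp_flux {Ω : Set E3} {γ : E3 → ℝ} (hγ : IsConductivity Ω γ) (a : L2 Ω) :
    MemLp (fun x => star ((γ x : ℂ) * a x)) 2 (volume.restrict Ω) := by
  obtain ⟨C, hC, hb⟩ := hγ.bounds
  refine MemLp.of_le_mul (c := C) (Lp.memLp a) ?_ ?_
  · exact ((Complex.continuous_ofReal.comp_aestronglyMeasurable hγ.aesm).mul
      (Lp.aestronglyMeasurable a)).star
  · filter_upwards [hb] with x hx
    have : 0 ≤ γ x := (inv_pos.2 hC).le.trans hx.1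
    rw [norm_star, norm_mul, Complex.norm_real, Real.norm_of_nonneg this]
    exact mul_le_mul_of_nonneg_right hx.2 (norm_nonneg _)

lemma IsConductivity.energy_eq_inner {Ω : Set E3} {γ : E3 → ℝ} (hγ : IsConductivity Ω γ)
    (u v : H1 Ω) :
    energy γ u v = ∑ i : Fin 3, inner ℂ ((hγ.memLp_flux (grad u i)).toLp _) (grad v i) := by
  refine Finset.sum_congr rfl fun i _ => ?_
  rw [L2.inner_def]
  refine integral_congr_ae ?_
  filter_upwards [(hγ.memLp_flux (grad u i)).coeFn_toLp] with x hx
  rw [hx]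
  simp [RCLike.inner_apply]
  ring

/-- For fixed `u ∈ H¹(Ω)`, the continuous linear functional `v ↦ ∫_Ω γ ∇u · ∇v dx`. -/
def energyCLM {Ω : Set E3} {γ : E3 → ℝ} (hγ : IsConductivity Ω γ) (u : H1 Ω) : H1 Ω →L[ℂ] ℂ where
  toFun := energy γ u
  map_add' v w := by
    simp only [hγ.energy_eq_inner, ← Finset.sum_add_distrib, ← inner_add_right]
    rfl
  map_smul' c v := by
    simp only [hγ.energy_eq_inner, RingHom.id_apply, smul_eq_mul, Finset.mul_sum,
      ← inner_smul_right]
    rfl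
  cont := by
    have he : energy γ u = fun v => ∑ i : Fin 3,
        inner ℂ ((hγ.memLp_flux (grad u i)).toLp _) (grad v i) :=
      funext fun v => hγ.energy_eq_inner u v
    change Continuous (energy γ u)
    rw [he]
    refine continuous_finsetSum _ fun i _ => Continuous.inner continuous_const ?_
    have h : Continuous fun p : L2Pair Ω => p.snd i := by fun_prop
    exact h.comp continuous_subtype_val

/-- The conormal derivative `γ ∂u/∂ν|_{∂Ω} ∈ H^{-1/2}(∂Ω)` of a weak solution `u` of
`∇ · γ∇u = 0`: it sends `v|_{∂Ω}` to `∫_Ω γ ∇u · ∇v dx`, as Green's formula demands. -/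
def conormal {Ω : Set E3} {γ : E3 → ℝ} (hγ : IsConductivity Ω γ) (u : H1 Ω)
    (hu : IsWeakSolution γ u) : DualTraceSpace Ω where
  toLinearMap := (H10 Ω).liftQ (energyCLM hγ u).toLinearMap fun v hv => hu v hv
  cont := (energyCLM hγ u).continuous.quotient_lift _

open Classical in
/-- The Dirichlet-to-Neumann map `Λ_γ : H^{1/2}(∂Ω) → H^{-1/2}(∂Ω)`, `Λ_γ f = γ ∂u/∂ν|_{∂Ω}`,
where `u` is the weak solution of `∇ · γ∇u = 0` in `Ω`, `u|_{∂Ω} = f`. -/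
def dnMap {Ω : Set E3} {γ : E3 → ℝ} (hγ : IsConductivity Ω γ) (f : TraceSpace Ω) :
    DualTraceSpace Ω :=
  if h : ∃ u : H1 Ω, IsWeakSolution γ u ∧ trace u = f then
    conormal hγ h.choose h.choose_spec.1
  else 0

/-- The exponential `x ↦ e^{i x · ζ}`, `ζ ∈ ℂ³`. -/
def expWave (ζ : Fin 3 → ℂ) (x : E3) : ℂ :=
  Complex.exp (Complex.I * ∑ j, (x j : ℂ) * ζ j)

lemma contDiff_expWave (ζ : Fin 3 → ℂ) : ContDiff ℝ ∞ (expWave ζ) := by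
  have h (j : Fin 3) : ContDiff ℝ ∞ fun x : E3 => (x j : ℂ) :=
    Complex.ofRealCLM.contDiff.comp (by fun_prop)
  unfold expWave
  fun_prop

/-- The trace of `e^{i x · ζ}` on `∂Ω`. -/
def expTrace {Ω : Set E3} (hΩ : IsOpen Ω) (hb : Bornology.IsBounded Ω) (ζ : Fin 3 → ℂ) :
    TraceSpace Ω :=
  trace (ofSmooth hΩ hb (expWave ζ) (contDiff_expWave ζ))

/-- `t^exp(ξ,ζ) = ∫_{∂Ω} e^{-i x · (ξ+ζ)} (Λ_γ - Λ₁) e^{i x · ζ} dσ(x)`, the integral being the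
bilinear pairing of `H^{-1/2}(∂Ω)` with `H^{1/2}(∂Ω)`. -/
def tExp {Ω : Set E3} (hΩ : IsOpen Ω) (hb : Bornology.IsBounded Ω) {γ : E3 → ℝ}
    (hγ : IsConductivity Ω γ) (ξ : E3) (ζ : Fin 3 → ℂ) : ℂ :=
  (dnMap hγ (expTrace hΩ hb ζ) - dnMap (isConductivity_one Ω) (expTrace hΩ hb ζ))
    (expTrace hΩ hb fun j => -((ξ j : ℂ) + ζ j))

/-- The complex frequency `-ξ/2 + i ζ_I`. -/
def cgoFreq (ξ ζI : E3) : Fin 3 → ℂ := fun j => -(ξ j : ℂ) / 2 + Complex.I * (ζI j : ℂ)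

end CalderonBorn

end

/-!
Both parts rest on the weighted gradient `T u = √γ ∇u`, a bounded operator from `H¹(Ω)` to
`L²(Ω)³` with `‖T u‖² = ∫_Ω γ |∇u|²`. Because `C_c^∞(Ω)` is stable under complex conjugation, `u`
is a weak solution exactly when `T u` is orthogonal to `T (H¹₀(Ω))` in the Hermitian inner product
(`isWeakSolution_iff`). By the Poincaré inequality (`poincare`) and the lower bound on `γ`, `T` is
bounded below on the complete space `H¹₀(Ω)`, so `T (H¹₀(Ω))` is closed. Orthogonal projection onto
it gives existence (`exists_weakSolution`), injectivity of `T` on `H¹₀(Ω)` gives uniqueness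
(`weakSolution_unique`).

The same orthogonality is Dirichlet's principle: a weak solution `u` with the boundary values of
`w` satisfies `‖T u‖ ≤ ‖T w‖`. With the Cauchy–Schwarz inequality,
`|⟨Λ_γ w|_{∂Ω}, v|_{∂Ω}⟩| ≤ ‖T w‖ ‖T v‖` for any extensions `w`, `v` of the two boundary values
(`norm_dnMap_le`). At a minimal frequency the two functions paired in `t^exp` are the exponentials
with frequencies `ζ_ξ = -ξ/2 + iζ_I` and `-(ξ + ζ_ξ) = -ξ/2 - iζ_I`, each of size `O(|ξ|)`.
Exponentials of bounded frequency are uniformly bounded on the bounded set `Ω`, so their gradients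
are `O(|ξ|)` in `L²(Ω)`, and both `Λ_γ` and `Λ_1` contribute `O(|ξ|²)`.
-/

open MeasureTheory
open scoped ContDiff

noncomputable section

namespace CalderonBorn

/-! ### Multiplication operators and conjugation on `L²(Ω)` -/

lemma memLp_real_mul {Ω : Set E3} {m : E3 → ℝ} {C : ℝ}
    (hm : AEStronglyMeasurable m (volume.restrict Ω))
    (hC : ∀ᵐ x ∂(volume.restrict Ω), |m x| ≤ C) (a : L2 Ω) :
    MemLp (fun x => (m x : ℂ) * a x) 2 (volume.restrict Ω) := by
  refine MemLp.of_le_mul (c := C) (Lp.memLp a)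
    ((Complex.continuous_ofReal.comp_aestronglyMeasurable hm).mul
      (Lp.aestronglyMeasurable a)) ?_
  filter_upwards [hC] with x hx
  rw [norm_mul, Complex.norm_real]
  exact mul_le_mul_of_nonneg_right hx (norm_nonneg _)

/-- Multiplication by an essentially bounded real function `m`, as an operator on `L²(Ω)`. -/
def mulL2 {Ω : Set E3} (m : E3 → ℝ) (C : ℝ) (hm : AEStronglyMeasurable m (volume.restrict Ω))
    (hC : ∀ᵐ x ∂(volume.restrict Ω), |m x| ≤ C) : L2 Ω →L[ℂ] L2 Ω :=
  have key := memLp_real_mul hm hC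
  LinearMap.mkContinuous
    { toFun := fun a => (key a).toLp _
      map_add' := fun a b => by
        refine Lp.ext ?_
        filter_upwards [(key (a + b)).coeFn_toLp, (key a).coeFn_toLp, (key b).coeFn_toLp,
          Lp.coeFn_add a b, Lp.coeFn_add ((key a).toLp _) ((key b).toLp _)] with x h1 h2 h3 h4 h5
        rw [h1, h5, Pi.add_apply, h2, h3, h4, Pi.add_apply, mul_add]
      map_smul' := fun c a => by
        refine Lp.ext ?_
        filter_upwards [(key (c • a)).coeFn_toLp, (key a).coeFn_toLp,
          Lp.coeFn_smul c a, Lp.coeFn_smul c ((key a).toLp _)] with x h1 h2 h3 h4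
        rw [h1, RingHom.id_apply, h4, Pi.smul_apply, h2, h3, Pi.smul_apply, smul_eq_mul,
          smul_eq_mul, mul_left_comm] }
    C fun a => by
      refine Lp.norm_le_mul_norm_of_ae_le_mul ?_
      filter_upwards [(key a).coeFn_toLp, hC] with x h1 h2
      change ‖((key a).toLp _) x‖ ≤ _
      rw [h1, norm_mul, Complex.norm_real]
      exact mul_le_mul_of_nonneg_right h2 (norm_nonneg _)

section
variable {Ω : Set E3} {m : E3 → ℝ} {C : ℝ} (hm : AEStronglyMeasurable m (volume.restrict Ω))
  (hC : ∀ᵐ x ∂(volume.restrict Ω), |m x| ≤ C)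

lemma coeFn_mulL2 (a : L2 Ω) :
    mulL2 m C hm hC a =ᵐ[volume.restrict Ω] fun x => (m x : ℂ) * a x :=
  (memLp_real_mul hm hC a).coeFn_toLp

lemma norm_mulL2_le (a : L2 Ω) : ‖mulL2 m C hm hC a‖ ≤ C * ‖a‖ := by
  refine Lp.norm_le_mul_norm_of_ae_le_mul ?_
  filter_upwards [coeFn_mulL2 hm hC a, hC] with x h1 h2
  rw [h1, norm_mul, Complex.norm_real]
  exact mul_le_mul_of_nonneg_right h2 (norm_nonneg _)

end

lemma norm_star_L2 {Ω : Set E3} (a : L2 Ω) : ‖star a‖ = ‖a‖ := by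
  apply le_antisymm <;> refine Lp.norm_le_norm_of_ae_le ?_ <;>
    filter_upwards [Lp.coeFn_star a] with x hx <;> rw [hx, Pi.star_apply, norm_star]

lemma inner_L2_eq {Ω : Set E3} (a b : L2 Ω) :
    inner ℂ a b = ∫ x in Ω, star (a x) * b x := by
  rw [L2.inner_def]
  refine integral_congr_ae (ae_of_all _ fun x => ?_)
  simp [RCLike.inner_apply, mul_comm]

lemma inner_star_L2 {Ω : Set E3} (a b : L2 Ω) :
    inner ℂ (star a) b = ∫ x in Ω, a x * b x := by
  rw [inner_L2_eq]
  refine integral_congr_ae ?_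
  filter_upwards [Lp.coeFn_star a] with x hx
  rw [hx, Pi.star_apply, star_star]

/-! ### Completeness of `H¹(Ω)` and `H¹₀(Ω)` -/

lemma continuous_integral_mul {Ω : Set E3} {g : E3 → ℂ} (hg : MemLp g 2 (volume.restrict Ω)) :
    Continuous fun a : L2 Ω => ∫ x in Ω, a x * g x := by
  have h : (fun a : L2 Ω => ∫ x in Ω, a x * g x) =
      fun a => inner ℂ (star (hg.toLp g)) a := by
    funext a
    rw [inner_star_L2]
    refine integral_congr_ae ?_
    filter_upwards [hg.coeFn_toLp] with x hx
    rw [hx, mul_comm]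
  rw [h]
  exact continuous_const.inner continuous_id

lemma isClosed_H1 (Ω : Set E3) : IsClosed (H1 Ω : Set (L2Pair Ω)) := by
  have h : (H1 Ω : Set (L2Pair Ω)) = ⋂ (φ : E3 → ℂ) (_ : IsTest Ω φ) (i : Fin 3),
      {p | ∫ x in Ω, p.fst x * pderiv i φ x = -∫ x in Ω, p.snd i x * φ x} := by
    ext p
    simp only [Set.mem_iInter]
    rfl
  rw [h]
  refine isClosed_iInter fun φ => isClosed_iInter fun hφ => isClosed_iInter fun i => ?_
  refine isClosed_eq ?_ ?_
  · have h1 : Continuous fun p : L2Pair Ω => p.fst := by fun_prop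
    exact (continuous_integral_mul (hφ.memLp_pderiv i)).comp h1
  · have h1 : Continuous fun p : L2Pair Ω => p.snd i := by fun_prop
    exact ((continuous_integral_mul hφ.memLp).comp h1).neg

instance completeSpace_H1 (Ω : Set E3) : CompleteSpace (H1 Ω) :=
  (isClosed_H1 Ω).completeSpace_coe

instance completeSpace_H10 (Ω : Set E3) : CompleteSpace (H10 Ω) :=
  (Submodule.isClosed_topologicalClosure _).completeSpace_coe

/-! ### Test functions as elements of `H¹₀(Ω)` -/

lemma represents_ofSmooth {Ω : Set E3} (hΩ : IsOpen Ω) (hb : Bornology.IsBounded Ω) {f : E3 → ℂ}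
    (hf : ContDiff ℝ ∞ f) : Represents (ofSmooth hΩ hb f hf) f :=
  ⟨(memLp_of_continuous hΩ hb hf.continuous).coeFn_toLp,
    fun i => (memLp_of_continuous hΩ hb (continuous_pderiv hf i)).coeFn_toLp⟩

lemma IsTest.mem_H10 {Ω : Set E3} {φ : E3 → ℂ} (hφ : IsTest Ω φ) {u : H1 Ω}
    (hu : Represents u φ) : u ∈ H10 Ω :=
  Submodule.le_topologicalClosure _ (Submodule.subset_span ⟨φ, hφ, hu⟩)

lemma pderiv_star {f : E3 → ℂ} (hf : ContDiff ℝ ∞ f) (i : Fin 3) (x : E3) :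
    pderiv i (fun y => star (f y)) x = star (pderiv i f x) := by
  have h := ((starL' ℝ : ℂ ≃L[ℝ] ℂ).hasFDerivAt (x := f x)).comp x
    ((hf.differentiable (by simp)) x).hasFDerivAt
  have h2 : fderiv ℝ (fun y => star (f y)) x = _ := h.fderiv
  rw [pderiv, h2]
  rfl

lemma IsTest.star {Ω : Set E3} {φ : E3 → ℂ} (hφ : IsTest Ω φ) :
    IsTest Ω fun x => star (φ x) where
  smooth := (starL' ℝ : ℂ ≃L[ℝ] ℂ).contDiff.comp hφ.smooth
  compact := hφ.compact.comp_left (star_zero ℂ)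
  support := (tsupport_comp_subset (star_zero ℂ) φ).trans hφ.support

/-- The elements of `H¹(Ω)` represented by test functions already form a subspace. -/
lemma exists_test_of_mem_span {Ω : Set E3} {u : H1 Ω}
    (hu : u ∈ Submodule.span ℂ {u : H1 Ω | ∃ φ : E3 → ℂ, IsTest Ω φ ∧ Represents u φ}) :
    ∃ φ : E3 → ℂ, IsTest Ω φ ∧ Represents u φ := by
  induction hu using Submodule.span_induction with
  | mem u hu => exact hu
  | zero =>
    refine ⟨fun _ => 0, ⟨contDiff_const, HasCompactSupport.zero, by simp [tsupport]⟩,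
      Lp.coeFn_zero _ _ _, fun i => (Lp.coeFn_zero _ _ _).trans ?_⟩
    exact ae_of_all _ fun x => by simp [pderiv]
  | add u v _ _ hu hv =>
    obtain ⟨φ, hφ, h1, h2⟩ := hu
    obtain ⟨ψ, hψ, h3, h4⟩ := hv
    refine ⟨φ + ψ, ⟨hφ.smooth.add hψ.smooth, hφ.compact.add hψ.compact,
      (tsupport_add φ ψ).trans (Set.union_subset hφ.support hψ.support)⟩,
      (Lp.coeFn_add _ _).trans (h1.add h3), fun i =>
      ((Lp.coeFn_add _ _).trans ((h2 i).add (h4 i))).trans (ae_of_all _ fun x => ?_)⟩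
    simp only [pderiv, Pi.add_apply]
    rw [fderiv_add (hφ.smooth.differentiable (by simp) x)
      (hψ.smooth.differentiable (by simp) x)]
    rfl
  | smul c u _ hu =>
    obtain ⟨φ, hφ, h1, h2⟩ := hu
    refine ⟨c • φ, ⟨contDiff_const.smul hφ.smooth, hφ.compact.smul_left,
      (closure_mono (Function.support_const_smul_subset c φ)).trans hφ.support⟩,
      (Lp.coeFn_smul _ _).trans (h1.const_smul c), fun i =>
      ((Lp.coeFn_smul _ _).trans ((h2 i).const_smul c)).trans (ae_of_all _ fun x => ?_)⟩
    simp only [pderiv, Pi.smul_apply]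
    rw [fderiv_const_smul (hφ.smooth.differentiable (by simp) x)]
    rfl

/-! ### The Poincaré inequality -/

lemma pderiv_coord_mul_star {φ : E3 → ℂ} (hφ : ContDiff ℝ ∞ φ) (x : E3) :
    pderiv 0 (fun y : E3 => (y 0 : ℂ) * star (φ y)) x
      = star (φ x) + (x 0 : ℂ) * star (pderiv 0 φ x) := by
  have h1 : HasFDerivAt (fun y : E3 => (y 0 : ℂ))
      (Complex.ofRealCLM.comp (EuclideanSpace.proj (𝕜 := ℝ) (0 : Fin 3))) x :=
    (Complex.ofRealCLM.comp (EuclideanSpace.proj (𝕜 := ℝ) (0 : Fin 3))).hasFDerivAt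
  have h2 : DifferentiableAt ℝ (fun y => star (φ y)) x :=
    ((starL' ℝ : ℂ ≃L[ℝ] ℂ).contDiff.comp hφ).differentiable (n := ∞) (by simp) x
  have h3 : fderiv ℝ (fun y : E3 => (y 0 : ℂ) * star (φ y)) x = _ :=
    (h1.mul h2.hasFDerivAt).fderiv
  have h4 := pderiv_star hφ 0 x
  rw [pderiv] at h4 ⊢
  rw [h3]
  simp only [add_apply, smul_apply, h4]
  simp
  ring

/-- The Poincaré inequality for a test function. Since `∂₀ x₀ = 1`, integration by parts against
`x₀ φ̄` bounds `‖φ‖²` by `2 ‖x₀‖_∞ ‖φ‖ ‖∂₀φ‖`. -/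
lemma norm_fst_le_of_test {Ω : Set E3} (hΩ : IsOpen Ω) {R : ℝ}
    (hR : ∀ x ∈ Ω, ‖x‖ ≤ R) {φ : E3 → ℂ} (hφ : IsTest Ω φ) {u : H1 Ω} (hu : Represents u φ) :
    ‖u.1.fst‖ ≤ 2 * R * ‖grad u 0‖ := by
  have hm : AEStronglyMeasurable (fun x : E3 => x 0) (volume.restrict Ω) :=
    (by fun_prop : Continuous fun x : E3 => x 0).aestronglyMeasurable
  have hC : ∀ᵐ x ∂(volume.restrict Ω), |x 0| ≤ R :=
    ae_restrict_of_forall_mem hΩ.measurableSet fun x hx =>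
      (PiLp.norm_apply_le x 0).trans (hR x hx)
  set X := mulL2 (fun x : E3 => x 0) R hm hC
  have hψ : IsTest Ω fun x : E3 => (x 0 : ℂ) * star (φ x) := by
    refine ⟨?_, hφ.star.compact.mul_left, ?_⟩
    · have h : ContDiff ℝ ∞ fun x : E3 => (x 0 : ℂ) :=
        Complex.ofRealCLM.contDiff.comp (by fun_prop)
      exact h.mul hφ.star.smooth
    · exact (tsupport_mul_subset_right (f := fun x : E3 => (x 0 : ℂ))).trans hφ.star.support
  have hw := u.2 _ hψ 0
  have e1 : ∫ x in Ω, u.1.fst x * pderiv 0 (fun y : E3 => (y 0 : ℂ) * star (φ y)) x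
      = inner ℂ u.1.fst u.1.fst + inner ℂ (X (grad u 0)) u.1.fst := by
    rw [← inner_add_left, inner_L2_eq]
    refine integral_congr_ae ?_
    filter_upwards [hu.1, hu.2 0, Lp.coeFn_add u.1.fst (X (grad u 0)),
      coeFn_mulL2 hm hC (grad u 0)] with x h1 h2 h3 h4
    rw [h3, Pi.add_apply, h4, pderiv_coord_mul_star hφ.smooth, h2, h1]
    simp
    ring
  have e2 : ∫ x in Ω, u.1.snd 0 x * ((x 0 : ℂ) * star (φ x))
      = inner ℂ (X u.1.fst) (grad u 0) := by
    rw [inner_L2_eq]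
    refine integral_congr_ae ?_
    filter_upwards [hu.1, coeFn_mulL2 hm hC u.1.fst] with x h1 h2
    rw [h2, h1, grad]
    simp
    ring
  rw [e1, e2] at hw
  have h5 : ‖u.1.fst‖ ^ 2 ≤ 2 * R * ‖grad u 0‖ * ‖u.1.fst‖ := by
    have h6 : inner ℂ u.1.fst u.1.fst
        = -(inner ℂ (X u.1.fst) (grad u 0) + inner ℂ (X (grad u 0)) u.1.fst) := by
      linear_combination hw
    calc ‖u.1.fst‖ ^ 2 = ‖(inner ℂ u.1.fst u.1.fst : ℂ)‖ := by
          rw [inner_self_eq_norm_sq_to_K]; simp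
      _ ≤ ‖(inner ℂ (X u.1.fst) (grad u 0) : ℂ)‖ + ‖(inner ℂ (X (grad u 0)) u.1.fst : ℂ)‖ := by
          rw [h6, norm_neg]; exact norm_add_le _ _
      _ ≤ (R * ‖u.1.fst‖) * ‖grad u 0‖ + (R * ‖grad u 0‖) * ‖u.1.fst‖ :=
          add_le_add
            ((norm_inner_le_norm _ _).trans
              (mul_le_mul_of_nonneg_right (norm_mulL2_le hm hC _) (norm_nonneg _)))
            ((norm_inner_le_norm _ _).trans
              (mul_le_mul_of_nonneg_right (norm_mulL2_le hm hC _) (norm_nonneg _)))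
      _ = _ := by ring
  rcases (norm_nonneg u.1.fst).eq_or_lt with h0 | h0
  · -- The sign of `R` is known only if `Ω` has a point; in the empty set `grad u 0 = 0`.
    rcases Ω.eq_empty_or_nonempty with rfl | ⟨y, hy⟩
    · have hz : grad u 0 = 0 := Lp.ext (by simp [Filter.EventuallyEq])
      rw [← h0, hz, norm_zero, mul_zero]
    · have := (norm_nonneg y).trans (hR y hy)
      rw [← h0]
      positivity
  · nlinarith

lemma continuous_grad {Ω : Set E3} (i : Fin 3) : Continuous fun u : H1 Ω => grad u i := by
  have h : Continuous fun p : L2Pair Ω => p.snd i := by fun_prop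
  exact h.comp continuous_subtype_val

lemma poincare {Ω : Set E3} (hΩ : IsOpen Ω) {R : ℝ} (hR : ∀ x ∈ Ω, ‖x‖ ≤ R) {u : H1 Ω}
    (hu : u ∈ H10 Ω) : ‖u.1.fst‖ ≤ 2 * R * ‖grad u 0‖ := by
  have h1 : Continuous fun u : H1 Ω => u.1.fst := by
    have h : Continuous fun p : L2Pair Ω => p.fst := by fun_prop
    exact h.comp continuous_subtype_val
  have hc : IsClosed {u : H1 Ω | ‖u.1.fst‖ ≤ 2 * R * ‖grad u 0‖} :=
    isClosed_le h1.norm (continuous_const.mul (continuous_grad 0).norm)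
  refine closure_minimal (fun v hv => ?_) hc hu
  obtain ⟨φ, hφ, hr⟩ := exists_test_of_mem_span hv
  exact norm_fst_le_of_test hΩ hR hφ hr

/-! ### The weighted gradient `√γ ∇u` -/

section
variable {Ω : Set E3} {γ : E3 → ℝ}

/-- A choice of constant `C > 0` with `C⁻¹ ≤ γ ≤ C` almost everywhere in `Ω`. -/
def IsConductivity.bound (hγ : IsConductivity Ω γ) : ℝ := hγ.bounds.choose

lemma IsConductivity.bound_pos (hγ : IsConductivity Ω γ) : 0 < hγ.bound :=
  hγ.bounds.choose_spec.1

lemma IsConductivity.ae_bound (hγ : IsConductivity Ω γ) :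
    ∀ᵐ x ∂(volume.restrict Ω), hγ.bound⁻¹ ≤ γ x ∧ γ x ≤ hγ.bound :=
  hγ.bounds.choose_spec.2

lemma IsConductivity.aesm_sqrt (hγ : IsConductivity Ω γ) :
    AEStronglyMeasurable (fun x => √(γ x)) (volume.restrict Ω) :=
  Real.continuous_sqrt.comp_aestronglyMeasurable hγ.aesm

lemma IsConductivity.ae_abs_sqrt_le (hγ : IsConductivity Ω γ) :
    ∀ᵐ x ∂(volume.restrict Ω), |√(γ x)| ≤ √hγ.bound := by
  filter_upwards [hγ.ae_bound] with x hx
  rw [abs_of_nonneg (Real.sqrt_nonneg _)]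
  exact Real.sqrt_le_sqrt hx.2

/-- Multiplication by `√γ` on `L²(Ω)`. -/
def IsConductivity.sqrtMul (hγ : IsConductivity Ω γ) : L2 Ω →L[ℂ] L2 Ω :=
  mulL2 (fun x => √(γ x)) (√hγ.bound) hγ.aesm_sqrt hγ.ae_abs_sqrt_le

lemma IsConductivity.coeFn_sqrtMul (hγ : IsConductivity Ω γ) (a : L2 Ω) :
    hγ.sqrtMul a =ᵐ[volume.restrict Ω] fun x => (√(γ x) : ℂ) * a x :=
  coeFn_mulL2 _ _ _

lemma IsConductivity.norm_sqrtMul_le (hγ : IsConductivity Ω γ) (a : L2 Ω) :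
    ‖hγ.sqrtMul a‖ ≤ √hγ.bound * ‖a‖ :=
  norm_mulL2_le _ _ _

lemma IsConductivity.norm_le_sqrtMul (hγ : IsConductivity Ω γ) (a : L2 Ω) :
    ‖a‖ ≤ √hγ.bound * ‖hγ.sqrtMul a‖ := by
  refine Lp.norm_le_mul_norm_of_ae_le_mul ?_
  filter_upwards [hγ.coeFn_sqrtMul a, hγ.ae_bound] with x h1 h2
  have hC := hγ.bound_pos
  rw [h1, norm_mul, Complex.norm_real, Real.norm_of_nonneg (Real.sqrt_nonneg _), ← mul_assoc,
    ← Real.sqrt_mul hC.le]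
  refine le_mul_of_one_le_left (norm_nonneg _) (Real.one_le_sqrt.2 ?_)
  calc (1 : ℝ) = hγ.bound * hγ.bound⁻¹ := (mul_inv_cancel₀ hC.ne').symm
    _ ≤ _ := mul_le_mul_of_nonneg_left h2.1 hC.le

/-- The weighted gradient `u ↦ √γ ∇u`, whose squared norm is the Dirichlet energy of `u`. -/
def weightedGrad (hγ : IsConductivity Ω γ) : H1 Ω →L[ℂ] PiLp 2 (fun _ : Fin 3 => L2 Ω) where
  toFun u := WithLp.toLp 2 fun i => hγ.sqrtMul (grad u i)
  map_add' u v := by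
    ext1 i
    exact map_add hγ.sqrtMul (grad u i) (grad v i)
  map_smul' c u := by
    ext1 i
    exact map_smul hγ.sqrtMul c (grad u i)
  cont := (PiLp.continuous_toLp 2 _).comp
    (continuous_pi fun i => hγ.sqrtMul.continuous.comp (continuous_grad i))

lemma weightedGrad_apply (hγ : IsConductivity Ω γ) (u : H1 Ω) (i : Fin 3) :
    weightedGrad hγ u i = hγ.sqrtMul (grad u i) := rfl

lemma energy_eq_inner_star (hγ : IsConductivity Ω γ) (u v : H1 Ω) :
    energy γ u v = inner ℂ
      (WithLp.toLp 2 fun i => star (weightedGrad hγ u i) : PiLp 2 (fun _ : Fin 3 => L2 Ω))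
      (weightedGrad hγ v) := by
  rw [PiLp.inner_apply]
  refine Finset.sum_congr rfl fun i _ => ?_
  refine Eq.trans ?_ (inner_star_L2 (weightedGrad hγ u i) (weightedGrad hγ v i)).symm
  refine integral_congr_ae ?_
  filter_upwards [hγ.coeFn_sqrtMul (grad u i), hγ.coeFn_sqrtMul (grad v i), hγ.ae_bound]
    with x h1 h2 h3
  have h4 : (√(γ x) : ℂ) * (√(γ x) : ℂ) = (γ x : ℂ) := by
    rw [← Complex.ofReal_mul, Real.mul_self_sqrt ((inv_pos.2 hγ.bound_pos).le.trans h3.1)]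
  rw [weightedGrad_apply, weightedGrad_apply, h1, h2, ← h4]
  ring

lemma norm_energy_le (hγ : IsConductivity Ω γ) (u v : H1 Ω) :
    ‖energy γ u v‖ ≤ ‖weightedGrad hγ u‖ * ‖weightedGrad hγ v‖ := by
  rw [energy_eq_inner_star hγ]
  refine (norm_inner_le_norm _ _).trans (le_of_eq ?_)
  congr 1
  rw [PiLp.norm_eq_of_L2, PiLp.norm_eq_of_L2]
  simp only [norm_star_L2]

/-- Against a test function `φ`, the Hermitian energy form is the bilinear one at `φ̄`. -/
lemma inner_weightedGrad (hγ : IsConductivity Ω γ) {p q : H1 Ω} {φ : E3 → ℂ}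
    (hp : Represents p φ) (hφ : ContDiff ℝ ∞ φ) (hq : Represents q fun x => star (φ x))
    (u : H1 Ω) : inner ℂ (weightedGrad hγ p) (weightedGrad hγ u) = energy γ q u := by
  rw [energy_eq_inner_star hγ]
  congr 1
  ext1 i
  refine Lp.ext ?_
  filter_upwards [hp.2 i, hq.2 i, hγ.coeFn_sqrtMul (grad p i), hγ.coeFn_sqrtMul (grad q i),
    Lp.coeFn_star (weightedGrad hγ q i)] with x h1 h2 h3 h4 h5
  rw [weightedGrad_apply, h3, h1]
  refine Eq.trans ?_ h5.symm
  rw [Pi.star_apply, weightedGrad_apply, h4, h2, pderiv_star hφ]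
  simp

lemma energy_comm (γ : E3 → ℝ) (u v : H1 Ω) : energy γ u v = energy γ v u := by
  simp only [energy, mul_comm]

/-- Weak solutions are the elements of `H¹(Ω)` orthogonal to `H¹₀(Ω)` in the Hermitian energy
form. The passage from the bilinear form uses that `C_c^∞(Ω)` is stable under conjugation. -/
lemma isWeakSolution_iff (hΩ : IsOpen Ω) (hb : Bornology.IsBounded Ω) (hγ : IsConductivity Ω γ)
    (u : H1 Ω) : IsWeakSolution γ u ↔
      ∀ φ ∈ H10 Ω, inner ℂ (weightedGrad hγ u) (weightedGrad hγ φ) = 0 := by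
  constructor
  · intro hu
    let L : H1 Ω →L[ℂ] ℂ := (innerSL ℂ (weightedGrad hγ u)).comp (weightedGrad hγ)
    have hL : H10 Ω ≤ L.ker := by
      refine Submodule.topologicalClosure_minimal _ (Submodule.span_le.2 ?_) L.isClosed_ker
      rintro p ⟨φ, hφ, hp⟩
      have hq := represents_ofSmooth hΩ hb hφ.star.smooth
      change inner ℂ (weightedGrad hγ u) (weightedGrad hγ p) = 0
      rw [inner_eq_zero_symm, inner_weightedGrad hγ hp hφ.smooth hq, energy_comm]
      exact hu _ (hφ.star.mem_H10 hq)
    exact fun φ hφ => hL hφ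
  · intro hu
    have hL : H10 Ω ≤ (energyCLM hγ u).ker := by
      refine Submodule.topologicalClosure_minimal _ (Submodule.span_le.2 ?_)
        (energyCLM hγ u).isClosed_ker
      rintro p ⟨φ, hφ, hp⟩
      have hq := represents_ofSmooth hΩ hb hφ.star.smooth
      change energy γ u p = 0
      rw [energy_comm, ← inner_weightedGrad hγ hq hφ.star.smooth (by simpa using hp),
        inner_eq_zero_symm]
      exact hu _ (hφ.star.mem_H10 hq)
    exact fun φ hφ => hL hφ

/-! ### The Dirichlet problem -/

/-- Coercivity of the energy on `H¹₀(Ω)`. -/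
lemma exists_norm_le_weightedGrad (hΩ : IsOpen Ω) (hb : Bornology.IsBounded Ω)
    (hγ : IsConductivity Ω γ) :
    ∃ A : ℝ, 0 ≤ A ∧ ∀ u ∈ H10 Ω, ‖u‖ ≤ A * ‖weightedGrad hγ u‖ := by
  obtain ⟨R, hR0, hR⟩ := hb.exists_pos_norm_le
  have hB := Real.sqrt_nonneg hγ.bound
  refine ⟨√((2 * R * √hγ.bound) ^ 2 + 3 * √hγ.bound ^ 2), Real.sqrt_nonneg _, fun u hu => ?_⟩
  have hT (i : Fin 3) : ‖grad u i‖ ≤ √hγ.bound * ‖weightedGrad hγ u‖ :=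
    (hγ.norm_le_sqrtMul _).trans
      (mul_le_mul_of_nonneg_left (PiLp.norm_apply_le (weightedGrad hγ u) i) hB)
  have h0 : ‖u.1.fst‖ ≤ 2 * R * √hγ.bound * ‖weightedGrad hγ u‖ :=
    (poincare hΩ hR hu).trans (by
      rw [mul_assoc (2 * R)]
      exact mul_le_mul_of_nonneg_left (hT 0) (by positivity))
  have h1 : ‖u‖ ^ 2 = ‖u.1.fst‖ ^ 2 + ∑ i, ‖grad u i‖ ^ 2 := by
    change ‖u.1‖ ^ 2 = _
    rw [WithLp.prod_norm_sq_eq_of_L2, PiLp.norm_sq_eq_of_L2]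
    rfl
  refine le_of_sq_le_sq ?_ (by positivity)
  rw [mul_pow, Real.sq_sqrt (by positivity), h1, Fin.sum_univ_three]
  have e0 := pow_le_pow_left₀ (norm_nonneg _) h0 2
  have e (i : Fin 3) := pow_le_pow_left₀ (norm_nonneg _) (hT i) 2
  have e1 := e 0
  have e2 := e 1
  have e3 := e 2
  rw [mul_pow] at e0 e1 e2 e3
  linarith

/-- Solvability: subtract from `w` the element of `H¹₀(Ω)` whose weighted gradient is the
orthogonal projection of `√γ ∇w` onto `√γ ∇ H¹₀(Ω)`, a closed subspace by coercivity. -/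
lemma exists_weakSolution (hΩ : IsOpen Ω) (hb : Bornology.IsBounded Ω)
    (hγ : IsConductivity Ω γ) (w : H1 Ω) : ∃ u : H1 Ω, IsWeakSolution γ u ∧ trace u = trace w := by
  obtain ⟨A, hA, hAu⟩ := exists_norm_le_weightedGrad hΩ hb hγ
  let T : H10 Ω →L[ℂ] PiLp 2 (fun _ : Fin 3 => L2 Ω) := (weightedGrad hγ).comp (H10 Ω).subtypeL
  have hanti : AntilipschitzWith ⟨A, hA⟩ T :=
    AddMonoidHomClass.antilipschitz_of_bound T fun u => hAu u.1 u.2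
  have hclosed : IsClosed (T.range : Set (PiLp 2 (fun _ : Fin 3 => L2 Ω))) :=
    hanti.isClosed_range T.uniformContinuous
  have : CompleteSpace T.range := hclosed.completeSpace_coe
  obtain ⟨p, hp⟩ := T.range.starProjection_apply_mem (weightedGrad hγ w)
  refine ⟨w - p, (isWeakSolution_iff hΩ hb hγ _).2 fun φ hφ => ?_, ?_⟩
  · have h := T.range.sub_starProjection_mem_orthogonal (weightedGrad hγ w)
    rw [← hp] at h
    rw [map_sub]
    exact (Submodule.mem_orthogonal' _ _).1 h _ ⟨⟨φ, hφ⟩, rfl⟩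
  · exact (Submodule.Quotient.eq _).2 (by simp)

lemma weakSolution_unique (hΩ : IsOpen Ω) (hb : Bornology.IsBounded Ω)
    (hγ : IsConductivity Ω γ) {u v : H1 Ω} (hu : IsWeakSolution γ u) (hv : IsWeakSolution γ v)
    (h : trace u = trace v) : u = v := by
  obtain ⟨A, -, hAu⟩ := exists_norm_le_weightedGrad hΩ hb hγ
  have hmem : u - v ∈ H10 Ω := (Submodule.Quotient.eq _).1 h
  have h0 : inner ℂ (weightedGrad hγ (u - v)) (weightedGrad hγ (u - v)) = 0 := by
    conv_lhs => rw [map_sub, inner_sub_left, ← map_sub]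
    rw [(isWeakSolution_iff hΩ hb hγ u).1 hu _ hmem,
      (isWeakSolution_iff hΩ hb hγ v).1 hv _ hmem, sub_zero]
  have h1 := hAu _ hmem
  rw [inner_self_eq_zero.1 h0, norm_zero, mul_zero] at h1
  exact sub_eq_zero.1 (norm_le_zero_iff.1 h1)

/-- Dirichlet's principle: a weak solution has the least energy among the functions with the same
boundary values. -/
lemma IsWeakSolution.norm_weightedGrad_le (hΩ : IsOpen Ω) (hb : Bornology.IsBounded Ω)
    (hγ : IsConductivity Ω γ) {u w : H1 Ω} (hu : IsWeakSolution γ u) (h : trace u = trace w) :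
    ‖weightedGrad hγ u‖ ≤ ‖weightedGrad hγ w‖ := by
  have hmem : u - w ∈ H10 Ω := (Submodule.Quotient.eq _).1 h
  have h0 := (isWeakSolution_iff hΩ hb hγ u).1 hu _ hmem
  rw [map_sub, inner_sub_right, sub_eq_zero] at h0
  have h1 : ‖weightedGrad hγ u‖ ^ 2 ≤ ‖weightedGrad hγ u‖ * ‖weightedGrad hγ w‖ := by
    calc ‖weightedGrad hγ u‖ ^ 2 = ‖(inner ℂ (weightedGrad hγ u) (weightedGrad hγ u) : ℂ)‖ := by
          rw [inner_self_eq_norm_sq_to_K]; simp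
      _ ≤ _ := h0 ▸ norm_inner_le_norm _ _
  rcases (norm_nonneg (weightedGrad hγ u)).eq_or_lt with h2 | h2
  · rw [← h2]
    exact norm_nonneg _
  · nlinarith

/-- The Dirichlet-to-Neumann form is bounded by the energies of arbitrary extensions of the two
boundary values. -/
lemma norm_dnMap_le (hΩ : IsOpen Ω) (hb : Bornology.IsBounded Ω) (hγ : IsConductivity Ω γ)
    (w v : H1 Ω) :
    ‖dnMap hγ (trace w) (trace v)‖ ≤ ‖weightedGrad hγ w‖ * ‖weightedGrad hγ v‖ := by
  have hex := exists_weakSolution hΩ hb hγ w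
  rw [dnMap, dif_pos hex]
  change ‖energy γ hex.choose v‖ ≤ _
  exact (norm_energy_le hγ _ _).trans (mul_le_mul_of_nonneg_right
    (hex.choose_spec.1.norm_weightedGrad_le hΩ hb hγ hex.choose_spec.2) (norm_nonneg _))

lemma norm_weightedGrad_le (hγ : IsConductivity Ω γ) {w : H1 Ω} {B : ℝ}
    (hw : ∀ i, ‖grad w i‖ ≤ B) : ‖weightedGrad hγ w‖ ≤ 2 * √hγ.bound * B := by
  have hB : 0 ≤ B := (norm_nonneg _).trans (hw 0)
  refine le_of_sq_le_sq ?_ (by positivity)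
  rw [PiLp.norm_sq_eq_of_L2, Fin.sum_univ_three]
  have e (i : Fin 3) : ‖weightedGrad hγ w i‖ ^ 2 ≤ (√hγ.bound * B) ^ 2 :=
    pow_le_pow_left₀ (norm_nonneg _) ((hγ.norm_sqrtMul_le _).trans
      (mul_le_mul_of_nonneg_left (hw i) (Real.sqrt_nonneg _))) 2
  have e1 := e 0
  have e2 := e 1
  have e3 := e 2
  nlinarith [sq_nonneg (√hγ.bound * B)]

end

/-! ### Exponentials of small frequency -/

lemma pderiv_expWave (ζ : Fin 3 → ℂ) (i : Fin 3) (x : E3) :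
    pderiv i (expWave ζ) x = Complex.I * ζ i * expWave ζ x := by
  have h1 (j : Fin 3) : HasFDerivAt (fun y : E3 => (y j : ℂ))
      (Complex.ofRealCLM.comp (EuclideanSpace.proj (𝕜 := ℝ) j)) x :=
    (Complex.ofRealCLM.comp (EuclideanSpace.proj (𝕜 := ℝ) j)).hasFDerivAt
  have h2 := ((HasFDerivAt.fun_sum (u := Finset.univ) fun j _ =>
    (h1 j).mul_const (ζ j)).const_mul Complex.I).cexp
  have h3 : fderiv ℝ (expWave ζ) x = _ := h2.fderiv
  rw [pderiv, h3]
  simp [expWave, PiLp.single_apply, apply_ite (fun t : ℝ => (t : ℂ))]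
  ring

lemma norm_expWave_le {R r : ℝ} (hR : 0 ≤ R) {ζ : Fin 3 → ℂ} (hζ : ∀ j, ‖ζ j‖ ≤ r) {x : E3}
    (hx : ‖x‖ ≤ R) : ‖expWave ζ x‖ ≤ Real.exp (3 * (R * r)) := by
  rw [expWave, Complex.norm_exp]
  refine Real.exp_le_exp.2 ((Complex.re_le_norm _).trans ?_)
  rw [norm_mul, Complex.norm_I, one_mul]
  refine (norm_sum_le_of_le _ fun j _ => ?_ : _ ≤ ∑ _j : Fin 3, R * r).trans (by simp)
  rw [norm_mul, Complex.norm_real]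
  exact mul_le_mul ((PiLp.norm_apply_le x j).trans hx) (hζ j) (norm_nonneg _) hR

/-- On a bounded set, `‖∇ e^{i x · ζ}‖_{L²} = O(|ζ|)` as `ζ → 0`. -/
lemma exists_norm_grad_expWave_le {Ω : Set E3} (hΩ : IsOpen Ω) (hb : Bornology.IsBounded Ω) :
    ∃ M : ℝ, 0 ≤ M ∧ ∀ (ζ : Fin 3 → ℂ) (r : ℝ), r ≤ 1 → (∀ j, ‖ζ j‖ ≤ r) →
      ∀ i, ‖grad (ofSmooth hΩ hb (expWave ζ) (contDiff_expWave ζ)) i‖ ≤ M * r := by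
  obtain ⟨R, hR0, hR⟩ := hb.exists_pos_norm_le
  have : IsFiniteMeasure (volume.restrict Ω) := ⟨by simpa using hb.measure_lt_top⟩
  refine ⟨(measureUnivNNReal (volume.restrict Ω) : ℝ) ^ (ENNReal.toReal 2)⁻¹ *
    Real.exp (3 * R), by positivity, fun ζ r hr hζ i => ?_⟩
  have hr0 : 0 ≤ r := (norm_nonneg _).trans (hζ 0)
  refine (Lp.norm_le_of_ae_bound (C := Real.exp (3 * R) * r) (by positivity) ?_).trans
    (le_of_eq (mul_assoc _ _ _).symm)
  filter_upwards [(represents_ofSmooth hΩ hb (contDiff_expWave ζ)).2 i,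
    ae_restrict_mem hΩ.measurableSet] with x hx hxΩ
  rw [hx, pderiv_expWave, norm_mul, norm_mul, Complex.norm_I, one_mul, mul_comm]
  refine mul_le_mul ((norm_expWave_le hR0.le hζ (hR x hxΩ)).trans ?_) (hζ i) (norm_nonneg _)
    (Real.exp_pos _).le
  refine Real.exp_le_exp.2 ?_
  nlinarith

lemma norm_cgoFreq_le {ξ ζI : E3} (h : ‖ζI‖ = ‖ξ‖ / 2) (j : Fin 3) :
    ‖cgoFreq ξ ζI j‖ ≤ ‖ξ‖ := by
  have h1 : ‖ξ j‖ ≤ ‖ξ‖ := PiLp.norm_apply_le ξ j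
  have h2 : ‖ζI j‖ ≤ ‖ζI‖ := PiLp.norm_apply_le ζI j
  refine (norm_add_le _ _).trans ?_
  simp only [norm_mul, norm_div, norm_neg, Complex.norm_real, Complex.norm_I, one_mul]
  simp only [Complex.norm_ofNat]
  linarith

/-- The second exponential in `t^exp` has a minimal frequency too, with `ζ_I` replaced by `-ζ_I`. -/
lemma neg_add_cgoFreq (ξ ζI : E3) :
    (fun j => -((ξ j : ℂ) + cgoFreq ξ ζI j)) = cgoFreq ξ (-ζI) := by
  funext j
  simp [cgoFreq]
  ring

lemma exists_norm_tExp_le {Ω : Set E3} (hΩ : IsOpen Ω) (hb : Bornology.IsBounded Ω) {γ : E3 → ℝ}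
    (hγ : IsConductivity Ω γ) : ∃ K : ℝ, 0 ≤ K ∧ ∀ ξ ζI : E3, ‖ξ‖ ≤ 1 → ‖ζI‖ = ‖ξ‖ / 2 →
      ‖tExp hΩ hb hγ ξ (cgoFreq ξ ζI)‖ ≤ K * ‖ξ‖ ^ 2 := by
  obtain ⟨M, hM, hgrad⟩ := exists_norm_grad_expWave_le hΩ hb
  have h1 := isConductivity_one Ω
  refine ⟨(2 * √hγ.bound * M) ^ 2 + (2 * √h1.bound * M) ^ 2, by positivity,
    fun ξ ζI hξ hζ => ?_⟩
  have hv : ∀ j, ‖cgoFreq ξ (-ζI) j‖ ≤ ‖ξ‖ := norm_cgoFreq_le (by rwa [norm_neg])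
  have key {ρ : E3 → ℝ} (hρ : IsConductivity Ω ρ) :
      ‖dnMap hρ (expTrace hΩ hb (cgoFreq ξ ζI)) (expTrace hΩ hb (cgoFreq ξ (-ζI)))‖
        ≤ (2 * √hρ.bound * M) ^ 2 * ‖ξ‖ ^ 2 := by
    refine (norm_dnMap_le hΩ hb hρ _ _).trans ?_
    refine (mul_le_mul (norm_weightedGrad_le hρ (hgrad _ _ hξ (norm_cgoFreq_le hζ)))
      (norm_weightedGrad_le hρ (hgrad _ _ hξ hv)) (norm_nonneg _) (by positivity)).trans
      (le_of_eq (by ring))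
  rw [tExp, neg_add_cgoFreq, sub_apply, add_mul]
  exact (norm_sub_le _ _).trans (add_le_add (key hγ) (key h1))

end CalderonBorn
end

theorem mainTheorem1 (Ω : Set CalderonBorn.E3) (hΩ : IsOpen Ω) (hb : Bornology.IsBounded Ω)
    (γ : CalderonBorn.E3 → ℝ) (hγ : CalderonBorn.IsConductivity Ω γ) :
    (∀ f : CalderonBorn.TraceSpace Ω,
      ∃! u : CalderonBorn.H1 Ω, CalderonBorn.IsWeakSolution γ u ∧ CalderonBorn.trace u = f) ∧
    ∃ K δ : ℝ, 0 < K ∧ 0 < δ ∧ ∀ ξ ζI : CalderonBorn.E3,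
      ‖ξ‖ < δ → inner ℝ ζI ξ = 0 → ‖ζI‖ = ‖ξ‖ / 2 →
        ‖CalderonBorn.tExp hΩ hb hγ ξ (CalderonBorn.cgoFreq ξ ζI)‖ ≤ K * ‖ξ‖ ^ 2 := by
  constructor
  · intro f
    obtain ⟨w, rfl⟩ := (CalderonBorn.H10 Ω).mkQ_surjective f
    obtain ⟨u, hu, hw⟩ := CalderonBorn.exists_weakSolution hΩ hb hγ w
    exact ⟨u, ⟨hu, hw⟩, fun v hv =>
      CalderonBorn.weakSolution_unique hΩ hb hγ hv.1 hu (hv.2.trans hw.symm)⟩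
  · obtain ⟨K, hK, h⟩ := CalderonBorn.exists_norm_tExp_le hΩ hb hγ
    -- `K + 1` because the constant has to be positive, while `K` is only known to be nonnegative.
    refine ⟨K + 1, 1, by positivity, one_pos, fun ξ ζI hξ _ hζ => (h ξ ζI hξ.le hζ).trans ?_⟩
    exact mul_le_mul_of_nonneg_right (by linarith) (by positivity)
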